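/- Let $\mathcal C$ be a small geometric category, i.e. a small regular category in which every set of subobjects of an object has a union (supremum in the poset of subobjects) and these unions are preserved by pullback along arbitrary morphisms. Let $J$ be the geometric topology on $\mathcal C$: a sieve $S$ on $c$ is $J$-covering if and only if the union of the images of the morphisms in $S$ is the maximal subobject of $c$. Call a morphism of $\mathcal C$ a cover if it does not factor through any proper subobject of its codomain, and call an object $A$ of the topos $\mathbf{Sh}(\mathcal C,J)$ of sheaves of sets well-supported if the unique morphism $A\to 1$ is an epimorphism. Then $\mathbf{Sh}(\mathcal C,J)$ has a separating set consisting of well-supported objects if and only if, for every object $c$ of $\mathcal C$, either $c$ is an initial object of $\mathcal C$ or the unique morphism $c\to 1_{\mathcal C}$ is a cover. -/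

import Mathlib

open CategoryTheory CategoryTheory.Limits

universe u

namespace GeometricSite

/-- A small category is *geometric* if it is regular, every set of subobjects of an object has a
union (a supremum in the poset of subobjects), and pullback along any morphism preserves these
unions. (Well-poweredness is automatic, because the category is small.) -/
class GeometricCategory (C : Type u) [SmallCategory C] : Prop extends Regular C where
  exists_union (X : C) (𝒰 : Set (Subobject X)) : ∃ V : Subobject X, IsLUB 𝒰 V
  pullback_union {X Y : C} (f : X ⟶ Y) (𝒰 : Set (Subobject Y)) (V : Subobject Y) :
    IsLUB 𝒰 V → IsLUB ((Subobject.pullback f).obj '' 𝒰) ((Subobject.pullback f).obj V)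

/-- A morphism is a *cover* if it factors through no proper subobject of its codomain. -/
def IsCover {C : Type u} [SmallCategory C] {X Y : C} (f : X ⟶ Y) : Prop :=
  ∀ U : Subobject Y, U.Factors f → U = ⊤

section Topology

variable {C : Type u} [SmallCategory C] [GeometricCategory C]

/-- The set of images of the morphisms belonging to a sieve. -/
noncomputable def sieveImages {X : C} (S : Sieve X) : Set (Subobject X) :=
  { U | ∃ (Y : C) (f : Y ⟶ X), S f ∧ U = imageSubobject f }

lemma imageSubobject_le_iff {X Y : C} (f : Y ⟶ X) (U : Subobject X) :
    imageSubobject f ≤ U ↔ U.Factors f := by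
  constructor
  · intro h
    have h1 : (imageSubobject f).Factors f := by
      simpa using imageSubobject_factors_comp_self f (𝟙 Y)
    exact Subobject.factors_of_le f h h1
  · intro h
    exact imageSubobject_le f (U.factorThru f h) (by simp)

/-- The union of the images of a sieve is the maximal subobject if and only if the morphisms of
the sieve do not all factor through one proper subobject. -/
lemma isLUB_sieveImages_top_iff {X : C} (S : Sieve X) :
    IsLUB (sieveImages S) ⊤ ↔
      ∀ U : Subobject X, (∀ ⦃Y : C⦄ (f : Y ⟶ X), S f → U.Factors f) → U = ⊤ := by
  constructor
  · intro h U hU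
    refine top_le_iff.1 (h.2 ?_)
    rintro _ ⟨Y, f, hf, rfl⟩
    exact (imageSubobject_le_iff f U).2 (hU f hf)
  · intro h
    refine ⟨fun _ _ => le_top, fun U hU => ?_⟩
    refine (h U fun Y f hf => ?_).ge
    exact (imageSubobject_le_iff f U).1 (hU ⟨Y, f, hf, rfl⟩)

lemma sieveImages_pullback {X Y : C} (S : Sieve X) (g : Y ⟶ X)
    (h : IsLUB (sieveImages S) ⊤) : IsLUB (sieveImages (S.pullback g)) ⊤ := by
  rw [isLUB_sieveImages_top_iff]
  intro U hU
  have h1 := GeometricCategory.pullback_union g _ _ h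
  rw [Subobject.pullback_top] at h1
  refine top_le_iff.1 (h1.2 ?_)
  rintro _ ⟨_, ⟨Z, f, hf, rfl⟩, rfl⟩
  let I := imageSubobject f
  have hsq := Subobject.isPullback g I
  have : StrongEpi (factorThruImageSubobject f) := by
    unfold factorThruImageSubobject
    infer_instance
  let q := pullback.snd (factorThruImageSubobject f) (Subobject.pullbackπ g I)
  have hq : U.Factors (q ≫ ((Subobject.pullback g).obj I).arrow) := by
    refine hU _ ?_
    have e : (q ≫ ((Subobject.pullback g).obj I).arrow) ≫ g =
        pullback.fst (factorThruImageSubobject f) (Subobject.pullbackπ g I) ≫ f := by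
      rw [Category.assoc, ← hsq.w, ← Category.assoc, ← pullback.condition, Category.assoc,
        imageSubobject_arrow_comp]
    change S ((q ≫ ((Subobject.pullback g).obj I).arrow) ≫ g)
    rw [e]
    exact S.downward_closed hf _
  have h2 : (Subobject.pullback ((Subobject.pullback g).obj I).arrow).obj U = ⊤ := by
    have : ExtremalEpi q := inferInstance
    exact ExtremalEpi.subobject_eq_top q ((Limits.pullback_factors_iff _ _ _).2 hq)
  have h3 := (Limits.pullback_factors_iff ((Subobject.pullback g).obj I).arrow U (𝟙 _)).1
    (by rw [h2]; exact Subobject.top_factors _)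
  rw [Category.id_comp] at h3
  exact Subobject.le_of_factors h3

variable (C) in
/-- The *geometric topology*: a sieve covers `X` if and only if the union of the images of its
morphisms is the whole of `X`. -/
noncomputable def geometricTopology : GrothendieckTopology C where
  sieves X := { S | IsLUB (sieveImages S) ⊤ }
  top_mem' X := by
    refine (isLUB_sieveImages_top_iff _).2 fun U hU => ?_
    refine top_le_iff.1 (Subobject.le_of_factors ?_)
    have h := Subobject.factors_of_factors_right (⊤ : Subobject X).arrow (hU (𝟙 X) trivial)
    rwa [Category.comp_id] at h
  pullback_stable' X Y S f hS := sieveImages_pullback S f hS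
  transitive' X S hS R hR := by
    refine (isLUB_sieveImages_top_iff R).2 fun U hU => ?_
    refine (isLUB_sieveImages_top_iff S).1 hS U fun Y f hf => ?_
    have h := (isLUB_sieveImages_top_iff _).1 (hR hf) ((Subobject.pullback f).obj U)
      fun Z g hg => (Limits.pullback_factors_iff _ _ _).2 (hU _ hg)
    have h' := (Limits.pullback_factors_iff f U (𝟙 Y)).1 (by rw [h]; exact Subobject.top_factors _)
    rwa [Category.id_comp] at h'

end Topology

/-- An object is *well-supported* if its unique morphism to the terminal object is an
epimorphism. -/
def IsWellSupported {E : Type*} [Category* E] [HasTerminal E] (A : E) : Prop :=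
  Epi (terminal.from A)

/-- There is a `u`-small set of well-supported objects which is separating. -/
def HasWellSupportedSeparatingSet (E : Type*) [Category* E] [HasTerminal E] : Prop :=
  ∃ P : ObjectProperty E, ObjectProperty.Small.{u} P ∧ P.IsSeparating ∧
    ∀ A : E, P A → IsWellSupported A

end GeometricSite

namespace GeometricSite

open Opposite

section Support

variable {C : Type u} [SmallCategory C]

/-! A sheaf is well-supported iff it locally has a section over every object. For the sheaf
associated to `c` this says that `c ⟶ 1` is a cover. Moreover `c` is initial iff the empty sieve
covers it, and then every sheaf has at most one section over `c`; so the non-initial representables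
always separate, and the condition makes them well-supported. Conversely, well-supportedness passes
forward along morphisms. If `c ⟶ 1` is not a cover, no well-supported sheaf maps to the sheaf of
`c`, so separation identifies any two maps from it to the sheaf of closed sieves. The closure of the
empty sieve on `c` is then maximal, and `c` is initial. -/

/-- The sieve of all morphisms to `Y` whose domain carries a section of the presheaf `P`. -/
def supportSieve (P : Cᵒᵖ ⥤ Type u) (Y : C) : Sieve Y where
  arrows Z _ := Nonempty (P.obj (op Z))
  downward_closed := fun ⟨x⟩ g => ⟨P.map g.op x⟩

/-- Membership of an arrow depends only on its domain. -/
lemma pullback_supportSieve (P : Cᵒᵖ ⥤ Type u) {Y Z : C} (f : Z ⟶ Y) :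
    (supportSieve P Y).pullback f = supportSieve P Z :=
  rfl

lemma supportSieve_mono {P Q : Cᵒᵖ ⥤ Type u} (φ : P ⟶ Q) (Y : C) :
    supportSieve P Y ≤ supportSieve Q Y :=
  fun _ _ ⟨x⟩ => ⟨φ.app _ x⟩

variable (J : GrothendieckTopology C)

lemma supportSieve_mem_of_isLocallySurjective {P Q : Cᵒᵖ ⥤ Type u} (φ : P ⟶ Q)
    [Presheaf.IsLocallySurjective J φ] {Y : C} (h : supportSieve Q Y ∈ J Y) :
    supportSieve P Y ∈ J Y := by
  refine J.transitive h _ fun Z f ⟨x⟩ => ?_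
  rw [pullback_supportSieve]
  refine J.superset_covering ?_ (Presheaf.imageSieve_mem J φ x)
  rintro W g ⟨t, -⟩
  exact ⟨t⟩

lemma nonempty_section_terminal (Y : C) :
    Nonempty ((⊤_ (Sheaf J (Type u))).obj.obj (op Y)) := by
  -- The constant one-point presheaf is a sheaf; its map to the chosen terminal sheaf supplies a
  -- section.
  let T : Sheaf J (Type u) :=
    ⟨(Functor.const _).obj PUnit, Presheaf.isSheaf_of_isTerminal J Types.isTerminalPUnit⟩
  exact ⟨(terminal.from T).hom.app (op Y) PUnit.unit⟩

lemma subsingleton_section_terminal (Y : C) :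
    Subsingleton ((⊤_ (Sheaf J (Type u))).obj.obj (op Y)) := by
  have h : IsTerminal ((⊤_ (Sheaf J (Type u))).obj.obj (op Y)) :=
    IsTerminal.isTerminalObj ((evaluation _ _).obj (op Y)) _
      (IsTerminal.isTerminalObj (sheafToPresheaf J (Type u)) _ terminalIsTerminal)
  exact (Types.isTerminalEquivUnique _ h).instSubsingleton

/-- A sheaf is well-supported if and only if every object is covered by objects carrying a
section. -/
lemma isWellSupported_iff (A : Sheaf J (Type u)) :
    IsWellSupported A ↔ ∀ Y : C, supportSieve A.obj Y ∈ J Y := by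
  unfold IsWellSupported
  rw [← Sheaf.isLocallySurjective_iff_epi]
  constructor
  · intro h Y
    obtain ⟨x⟩ := nonempty_section_terminal J Y
    refine J.superset_covering ?_ (Presheaf.imageSieve_mem J (terminal.from A).hom x)
    rintro W g ⟨t, -⟩
    exact ⟨t⟩
  · intro h
    refine ⟨fun {Y} s => J.superset_covering ?_ (h Y)⟩
    rintro W g ⟨t⟩
    have := subsingleton_section_terminal J W
    exact ⟨t, Subsingleton.elim _ _⟩

/-- The sheaf associated to a representable presheaf. -/
noncomputable abbrev sheafifiedYoneda (c : C) : Sheaf J (Type u) :=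
  (presheafToSheaf J (Type u)).obj (yoneda.obj c)

/-- Morphisms from the sheaf associated to `yoneda.obj c` to `A` are sections of `A` over `c`. -/
noncomputable def sheafifiedYonedaEquiv (c : C) (A : Sheaf J (Type u)) :
    (sheafifiedYoneda J c ⟶ A) ≃ A.obj.obj (op c) :=
  ((sheafificationAdjunction J (Type u)).homEquiv _ _).trans yonedaEquiv

lemma sheafifiedYonedaEquiv_comp {c : C} {A B : Sheaf J (Type u)} (h : sheafifiedYoneda J c ⟶ A)
    (φ : A ⟶ B) : sheafifiedYonedaEquiv J c B (h ≫ φ) =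
      φ.hom.app (op c) (sheafifiedYonedaEquiv J c A h) := by
  simp only [sheafifiedYonedaEquiv, Equiv.trans_apply, Adjunction.homEquiv_naturality_right]
  rfl

/-- The sheafification unit is locally surjective, so sections of the sheaf lift locally to the
presheaf; the converse only needs the unit to be a map. -/
lemma supportSieve_sheafifiedYoneda_mem_iff (c Y : C) :
    supportSieve (sheafifiedYoneda J c).obj Y ∈ J Y ↔ supportSieve (yoneda.obj c) Y ∈ J Y :=
  ⟨supportSieve_mem_of_isLocallySurjective J (toSheafify J (yoneda.obj c)),
    J.superset_covering (supportSieve_mono (toSheafify J (yoneda.obj c)) Y)⟩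

lemma subsingleton_section_of_bot_mem {c : C} (h : (⊥ : Sieve c) ∈ J c) (A : Sheaf J (Type u)) :
    Subsingleton (A.obj.obj (op c)) :=
  ⟨fun _ _ => (((isSheaf_iff_isSheaf_of_type J _).1 A.property) _ h).isSeparatedFor.ext
    fun _ _ hf => hf.elim⟩

end Support

section Geometric

variable {C : Type u} [SmallCategory C] [GeometricCategory C]

lemma mem_geometricTopology_iff {X : C} (S : Sieve X) :
    S ∈ geometricTopology C X ↔
      ∀ U : Subobject X, (∀ ⦃Y : C⦄ (f : Y ⟶ X), S f → U.Factors f) → U = ⊤ :=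
  isLUB_sieveImages_top_iff S

lemma supportSieve_yoneda_mem_iff_isCover (c : C) :
    supportSieve (yoneda.obj c) (⊤_ C) ∈ geometricTopology C (⊤_ C) ↔
      IsCover (terminal.from c) := by
  rw [mem_geometricTopology_iff]
  refine forall_congr' fun U => imp_congr_left ⟨fun h => h _ ⟨𝟙 c⟩, ?_⟩
  rintro h Y f ⟨g⟩
  rw [Subsingleton.elim f (g ≫ terminal.from c)]
  exact Subobject.factors_of_factors_right g h

lemma isWellSupported_sheafifiedYoneda_iff (c : C) :
    IsWellSupported (sheafifiedYoneda (geometricTopology C) c) ↔ IsCover (terminal.from c) := by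
  rw [isWellSupported_iff, ← supportSieve_yoneda_mem_iff_isCover,
    ← supportSieve_sheafifiedYoneda_mem_iff]
  -- Every support sieve is pulled back from the one on the terminal object.
  exact ⟨fun h => h _, fun h Y => (geometricTopology C).pullback_stable (terminal.from Y) h⟩

/-- When the empty sieve covers, the factorization condition is vacuous, so every subobject of `X`
is maximal. -/
lemma isIso_of_mono_of_bot_mem {X Y : C} (h : (⊥ : Sieve X) ∈ geometricTopology C X)
    (m : Y ⟶ X) [Mono m] : IsIso m := by
  rw [Subobject.isIso_iff_mk_eq_top]
  exact (mem_geometricTopology_iff _).1 h _ fun _ _ hf => hf.elim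

lemma bot_mem_of_hom {X Y : C} (h : (⊥ : Sieve X) ∈ geometricTopology C X) (f : Y ⟶ X) :
    (⊥ : Sieve Y) ∈ geometricTopology C Y :=
  (geometricTopology C).superset_covering (fun _ _ hg => hg)
    ((geometricTopology C).pullback_stable f h)

/-- An object of a geometric category is covered by the empty sieve if and only if it is
initial. -/
lemma bot_mem_iff_isInitial (c : C) :
    (⊥ : Sieve c) ∈ geometricTopology C c ↔ Nonempty (IsInitial c) := by
  constructor
  · intro h
    have hex (d : C) : Nonempty (c ⟶ d) := by
      -- The kernel pair of `p` maps to `c`, so the empty sieve covers it too and the diagonal is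
      -- invertible. Thus `p` is monic, hence invertible.
      let p : c ⨯ d ⟶ c := prod.fst
      have := isIso_of_mono_of_bot_mem (bot_mem_of_hom h (pullback.fst p p ≫ p))
        (pullback.diagonal p)
      have hp : Mono p := (pullback.isIso_diagonal_iff p).1 this
      have := isIso_of_mono_of_bot_mem h p
      exact ⟨inv p ≫ prod.snd⟩
    have huniq (d : C) (f g : c ⟶ d) : f = g := by
      have := isIso_of_mono_of_bot_mem h (equalizer.ι f g)
      exact (cancel_epi (equalizer.ι f g)).1 (equalizer.condition f g)
    exact ⟨IsInitial.ofUniqueHom (fun d => (hex d).some) fun d _ => huniq d _ _⟩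
  · rintro ⟨hc⟩
    rw [mem_geometricTopology_iff]
    intro U _
    -- By initiality, the inclusion of `U` has a section.
    have : U.Factors (𝟙 c) := (Subobject.factors_iff _ _).2 ⟨hc.to _, hc.hom_ext _ _⟩
    exact top_le_iff.1 (Subobject.le_of_factors
      (by simpa using Subobject.factors_of_factors_right (⊤ : Subobject c).arrow this))

lemma isInitial_or_isCover_of_isSeparating
    {P : ObjectProperty (Sheaf (geometricTopology C) (Type u))} (hP : P.IsSeparating)
    (hws : ∀ A, P A → IsWellSupported A) (c : C) :
    Nonempty (IsInitial c) ∨ IsCover (terminal.from c) := by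
  rw [or_iff_not_imp_right, ← isWellSupported_sheafifiedYoneda_iff, ← bot_mem_iff_isInitial,
    ← GrothendieckTopology.close_eq_top_iff_mem]
  intro hc
  let J := geometricTopology C
  let Ω : Sheaf J (Type u) :=
    ⟨(Functor.closedSieves J).toFunctor, (isSheaf_iff_isSheaf_of_type J _).2 (classifier_isSheaf J)⟩
  let e := sheafifiedYonedaEquiv J c Ω
  let s : Ω.obj.obj (op c) := ⟨J.close ⊥, J.close_isClosed _⟩
  let t : Ω.obj.obj (op c) := ⟨(⊤ : Sieve c), fun _ _ _ => trivial⟩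
  have key : e.symm s = e.symm t := by
    -- The separation test is vacuous: a map `h` from a well-supported `A` would make the sheaf of
    -- `c` well-supported.
    refine hP _ _ fun A hA h => (hc ?_).elim
    rw [isWellSupported_iff]
    exact fun Y => J.superset_covering (supportSieve_mono h.hom Y)
      ((isWellSupported_iff J A).1 (hws A hA) Y)
  exact congrArg Subtype.val (e.symm.injective key)

/-- The sheaves associated to non-initial objects. -/
def nonInitialRepresentables (C : Type u) [SmallCategory C] [GeometricCategory C] :
    ObjectProperty (Sheaf (geometricTopology C) (Type u)) :=
  ObjectProperty.ofObj fun c : { c : C // ¬ Nonempty (IsInitial c) } =>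
    sheafifiedYoneda (geometricTopology C) c.1

lemma isSeparating_nonInitialRepresentables : (nonInitialRepresentables C).IsSeparating := by
  intro A B f g H
  ext ⟨c⟩ x
  by_cases hc : Nonempty (IsInitial c)
  · have := subsingleton_section_of_bot_mem _ ((bot_mem_iff_isInitial c).2 hc) B
    exact Subsingleton.elim _ _
  · obtain ⟨h, rfl⟩ := (sheafifiedYonedaEquiv _ c A).surjective x
    have := H _ (ObjectProperty.ofObj_apply _ ⟨c, hc⟩) h
    have := congrArg (sheafifiedYonedaEquiv _ c B) this
    rwa [sheafifiedYonedaEquiv_comp, sheafifiedYonedaEquiv_comp] at this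

end Geometric

end GeometricSite

theorem corollary7p3 (C : Type u) [SmallCategory C] [GeometricSite.GeometricCategory C] :
    GeometricSite.HasWellSupportedSeparatingSet.{u}
        (Sheaf (GeometricSite.geometricTopology C) (Type u)) ↔
      ∀ c : C, Nonempty (IsInitial c) ∨ GeometricSite.IsCover (terminal.from c) := by
  constructor
  · rintro ⟨P, -, hP, hws⟩
    exact GeometricSite.isInitial_or_isCover_of_isSeparating hP hws
  · intro h
    refine ⟨GeometricSite.nonInitialRepresentables C, ?_,
      GeometricSite.isSeparating_nonInitialRepresentables, ?_⟩
    · unfold GeometricSite.nonInitialRepresentables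
      infer_instance
    · rintro _ ⟨c⟩
      exact (GeometricSite.isWellSupported_sheafifiedYoneda_iff c.1).2 ((h c.1).resolve_left c.2)
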